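/- Let $\mathbb D$ be a nonempty, dense, totally ordered set without endpoints (such as $\mathbb Q$ or $\mathbb R$), from which the values in databases and the constants in queries are taken. A database is a collection of facts over a relational schema. A Boolean CQAC is a query $Q() \,{:-}\, Q_0,\beta$, where $Q_0$ is a finite set of relational subgoals (whose arguments are variables or constants) and $\beta$ is a finite set of arithmetic comparisons (ACs) $X\,\theta\,Y$, with $\theta\in\{<,>,\le,\ge,=,\ne\}$, $X$ a variable and $Y$ a variable or a constant. The set $\beta$ is assumed satisfiable in $\mathbb D$, and every variable occurring in $\beta$ is assumed to occur in $Q_0$. For queries, $Q'\sqsubseteq Q$ means that $Q$ is true on every database on which $Q'$ is true; the same notion is used for Datalog queries. The closure of $\beta$ is the set of all ACs implied by $\beta$. A closed RSI1 query is a Boolean CQAC all of whose ACs are of the form $X\le c$ (closed LSI) or $X\ge c$ (closed RSI) with $c$ a constant, at most one of them being of the form $X\ge c$. Let $Q_1$ be a closed RSI1 query and let $Q_2$ be any Boolean CQAC over the same schema, with set of ACs $\beta_2$. **The conjunctive query $Q_2^{CQ}$.** Replace the terms in $Q_2$ that $\beta_2$ forces to be equal by a single term (by the constant, if they are forced to be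 equal to a constant; otherwise by one of the variables); this changes nothing if $\beta_2$ implies no equalities. The body of the Boolean conjunctive query $Q_2^{CQ}$ consists of the relational subgoals of $Q_2$, together with a subgoal $U_{\theta c}(t)$, $\theta\in\{\le,\ge\}$, for each comparison $t\,\theta\,c$ implied by $\beta_2$ with $c$ a constant occurring in $Q_2$, and a subgoal $U(s,t)$ for each comparison $s\le t$ implied by $\beta_2$. Here $s,t$ range over the terms in the relational subgoals of $Q_2$, and $U$, $U_{\le c}$, $U_{\ge c}$ are new EDB predicates. **The Datalog query $Q_1^{Datalog}$.** Its EDB predicates are the relations of the schema and $U$, $U_{\le c}$, $U_{\ge c}$. Its IDB predicates are the unary predicates $I_{\le c}, I_{\ge c}, J_{\le c}, J_{\ge c}$ for the constants $c$ in the ACs of $Q_1$, and the Boolean query predicate. The atoms $I_{\theta c}(X)$ and $J_{\theta c}(X)$ are the $I$-atom and the $J$-atom associated with the AC $X\,\theta\,c$. The rules are the following. * Query rule: the head is the query predicate; the body consists of all relational subgoals of $Q_1$ and the $I$-atoms associated with all ACs of $Q_1$. * Mapping rules: for each AC $e$ of $Q_1$, a rule whose head is the $J$-atom associated with $e$ and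 whose body is the body of the query rule without the $I$-atom associated with $e$. * Coupling rules: for each pair $c_1\le c_2$ of constants in the ACs of $Q_1$, the three rules $$I_{\le c_2}(X) \,{:-}\, J_{\ge c_1}(X),\qquad I_{\ge c_1}(X) \,{:-}\, J_{\le c_2}(X),\qquad I_{\le c_2}(X) \,{:-}\, J_{\ge c_1}(Y),U(X,Y).$$ * Link rules: for each $\theta\in\{\le,\ge\}$, each constant $c$ occurring in $Q_2$ and each constant $c_1$ in the ACs of $Q_1$ such that $X\,\theta\,c$ implies $X\,\theta\,c_1$, the rule $I_{\theta c_1}(X) \,{:-}\, U_{\theta c}(X)$. Then $Q_2\sqsubseteq Q_1$ if and only if $Q_2^{CQ}\sqsubseteq Q_1^{Datalog}$. -/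

import Mathlib

universe u v w

namespace CQAC

/-! ### Relational schemas, atoms, databases -/

/-- A relational schema: relation symbols with their arities. -/
structure Schema : Type (u + 1) where
  Sym : Type u
  arity : Sym → ℕ

/-- Variables are drawn from a fixed countably infinite supply. -/
abbrev Var : Type := ℕ

/-- A term is a variable or a constant of the domain `Dom`. -/
inductive Term (Dom : Type v) : Type v where
  | var (x : Var) : Term Dom
  | const (c : Dom) : Term Dom

/-- The value of a term under an assignment of the variables. -/
def Term.eval {Dom : Type v} (h : Var → Dom) : Term Dom → Dom
  | .var x => h x
  | .const c => c

/-- An atom `r(t₁, …, tₙ)` whose arguments are taken from `T`. -/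
structure Atom (S : Schema.{u}) (T : Type v) : Type (max u v) where
  sym : S.Sym
  args : Fin (S.arity sym) → T

def Atom.map {S : Schema.{u}} {T : Type v} {T' : Type w} (f : T → T') (a : Atom S T) :
    Atom S T' :=
  ⟨a.sym, fun i => f (a.args i)⟩

/-- A database is a collection of facts, i.e. of atoms whose arguments are domain values. -/
abbrev Database (S : Schema.{u}) (Dom : Type v) : Type (max u v) := Set (Atom S Dom)

/-! ### Boolean conjunctive queries -/

/-- A Boolean conjunctive query. -/
structure CQ (S : Schema.{u}) (Dom : Type v) : Type (max u v) where
  body : Finset (Atom S (Term Dom))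

/-- The Boolean query `Q` is true on `D`: some assignment makes all the subgoals facts of `D`. -/
def CQ.TrueOn {S : Schema.{u}} {Dom : Type v} (Q : CQ S Dom) (D : Database S Dom) : Prop :=
  ∃ h : Var → Dom, ∀ a ∈ Q.body, a.map (Term.eval h) ∈ D

/-! ### Arithmetic comparisons -/

/-- The comparison symbols `<, >, ≤, ≥, =, ≠`. -/
inductive Cmp : Type where
  | lt | gt | le | ge | eq | ne

def Cmp.Holds {Dom : Type v} [LinearOrder Dom] : Cmp → Dom → Dom → Prop
  | .lt, a, b => a < b
  | .gt, a, b => a > b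
  | .le, a, b => a ≤ b
  | .ge, a, b => a ≥ b
  | .eq, a, b => a = b
  | .ne, a, b => a ≠ b

/-- An arithmetic comparison `X θ Y`, with `X` a variable and `Y` a variable or a constant. -/
structure AC (Dom : Type v) : Type v where
  lhs : Var
  op : Cmp
  rhs : Term Dom

def AC.Holds {Dom : Type v} [LinearOrder Dom] (h : Var → Dom) (e : AC Dom) : Prop :=
  e.op.Holds (h e.lhs) (e.rhs.eval h)

/-- The two directions of a closed semi-interval comparison: `le` is left (`X ≤ c`), `ge` is
right (`X ≥ c`). -/
inductive Dir : Type where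
  | le | ge

def Dir.toCmp : Dir → Cmp
  | .le => .le
  | .ge => .ge

/-- A closed semi-interval comparison `X ≤ c` or `X ≥ c`. -/
structure ClosedSI (Dom : Type v) : Type v where
  var : Var
  dir : Dir
  const : Dom

def ClosedSI.toAC {Dom : Type v} (s : ClosedSI Dom) : AC Dom :=
  ⟨s.var, s.dir.toCmp, .const s.const⟩

theorem ClosedSI.toAC_injective {Dom : Type v} :
    Function.Injective (ClosedSI.toAC : ClosedSI Dom → AC Dom) := by
  rintro ⟨x, d, c⟩ ⟨x', d', c'⟩ h
  cases d <;> cases d' <;> simp_all [ClosedSI.toAC, Dir.toCmp]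

theorem Term.const_injective {Dom : Type v} :
    Function.Injective (Term.const : Dom → Term Dom) := by
  intro a b h
  cases h
  rfl

/-! ### Boolean conjunctive queries with arithmetic comparisons -/

/-- A Boolean conjunctive query with arithmetic comparisons, `Q = Q₀ + β`: finitely many relational
subgoals `rel` and comparisons `acs`, such that the comparisons are safe (their variables occur in
relational subgoals) and not contradictory. -/
structure Query (S : Schema.{u}) (Dom : Type v) [LinearOrder Dom] : Type (max u v) where
  rel : Finset (Atom S (Term Dom))
  acs : Finset (AC Dom)
  safe : ∀ e ∈ acs, ∀ x : Var, (x = e.lhs ∨ Term.var x = e.rhs) →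
    ∃ a ∈ rel, ∃ i, a.args i = Term.var x
  consistent : ∃ h : Var → Dom, ∀ e ∈ acs, e.Holds h

namespace Query

variable {S : Schema.{u}} {Dom : Type v} [LinearOrder Dom]

/-- The Boolean query `Q` is true on `D`. -/
def TrueOn (Q : Query S Dom) (D : Database S Dom) : Prop :=
  ∃ h : Var → Dom, (∀ a ∈ Q.rel, a.map (Term.eval h) ∈ D) ∧ ∀ e ∈ Q.acs, e.Holds h

/-- Containment `Q₂ ⊑ Q₁`. -/
def ContainedIn (Q₂ Q₁ : Query S Dom) : Prop :=
  ∀ D : Database S Dom, Q₂.TrueOn D → Q₁.TrueOn D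

/-- The comparison `s θ t` is implied by the comparisons of `Q`, i.e. lies in their closure. -/
def Implies (Q : Query S Dom) (s : Term Dom) (θ : Cmp) (t : Term Dom) : Prop :=
  ∀ h : Var → Dom, (∀ e ∈ Q.acs, e.Holds h) → θ.Holds (s.eval h) (t.eval h)

/-- The closed semi-interval comparisons of `Q`. -/
noncomputable def closedSIs (Q : Query S Dom) : Finset (ClosedSI Dom) :=
  Q.acs.preimage ClosedSI.toAC ClosedSI.toAC_injective.injOn

/-- `Q` is an RSI1 query with closed comparisons: every comparison is of the form `X ≤ c` or
`X ≥ c`, and at most one is of the form `X ≥ c`. -/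
def IsClosedRSI1 (Q : Query S Dom) : Prop :=
  (∀ e ∈ Q.acs, ∃ s : ClosedSI Dom, s.toAC = e) ∧
  ∀ s ∈ Q.closedSIs, ∀ s' ∈ Q.closedSIs, s.dir = .ge → s'.dir = .ge → s = s'

open scoped Classical in
/-- The variables and constants occurring in the relational subgoals. -/
noncomputable def relTerms (Q : Query S Dom) : Finset (Term Dom) :=
  Q.rel.biUnion fun a => Finset.univ.image a.args

open scoped Classical in
/-- The constants occurring in the comparisons. -/
noncomputable def acConsts (Q : Query S Dom) : Finset Dom :=
  (Q.acs.image AC.rhs).preimage Term.const Term.const_injective.injOn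

open scoped Classical in
/-- The constants occurring in `Q`, in relational subgoals or in comparisons. -/
noncomputable def consts (Q : Query S Dom) : Finset Dom :=
  Q.relTerms.preimage Term.const Term.const_injective.injOn ∪ Q.acConsts

open scoped Classical in
/-- All the terms that the comparisons of `Q` force to be equal are replaced by a single one: by the
constant if they are forced to be equal to a constant, else by the first variable among them. If no
equalities are implied then this changes nothing. -/
noncomputable def rep (Q : Query S Dom) (t : Term Dom) : Term Dom :=
  if h : ∃ c : Dom, Q.Implies t .eq (.const c) then .const h.choose
  else .var (sInf {y : Var | Q.Implies t .eq (.var y)})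

end Query

/-! ### Datalog queries -/

/-- A Datalog rule with EDB schema `E` and IDB schema `I`. -/
structure Rule (E : Schema.{u}) (I : Schema.{w}) (Dom : Type v) : Type (max u v w) where
  head : Atom I (Term Dom)
  edb : Finset (Atom E (Term Dom))
  idb : Finset (Atom I (Term Dom))

/-- A Boolean Datalog query: finitely many rules and a query predicate of arity `0`. -/
structure Datalog (E : Schema.{u}) (I : Schema.{w}) (Dom : Type v) : Type (max u v w) where
  rules : Finset (Rule E I Dom)
  goal : I.Sym
  goal_arity : I.arity goal = 0

/-- The derived facts: those obtained by firing the rules, starting from the database. -/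
inductive Datalog.Derives {E : Schema.{u}} {I : Schema.{w}} {Dom : Type v} (P : Datalog E I Dom)
    (D : Database E Dom) : Atom I Dom → Prop where
  | fire (r : Rule E I Dom) (hr : r ∈ P.rules) (h : Var → Dom)
      (hedb : ∀ a ∈ r.edb, a.map (Term.eval h) ∈ D)
      (hidb : ∀ b ∈ r.idb, Datalog.Derives P D (b.map (Term.eval h))) :
      Datalog.Derives P D (r.head.map (Term.eval h))

/-- The Boolean Datalog query is true on `D`: the fact of its query predicate is derived. -/
def Datalog.TrueOn {E : Schema.{u}} {I : Schema.{w}} {Dom : Type v} (P : Datalog E I Dom)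
    (D : Database E Dom) : Prop :=
  P.Derives D ⟨P.goal, fun i => (Fin.cast P.goal_arity i).elim0⟩

/-- Containment of a conjunctive query in a Datalog query over the same EDB schema. -/
def CQ.ContainedIn {E : Schema.{u}} {I : Schema.{w}} {Dom : Type v} (Q : CQ E Dom)
    (P : Datalog E I Dom) : Prop :=
  ∀ D : Database E Dom, Q.TrueOn D → P.TrueOn D

/-! ### The predicates of the transformed queries -/

/-- EDB predicates: the relations of the given schema, the binary predicate `U`, and the unary
predicates `U_{≤ c}` and `U_{≥ c}`. -/
inductive EDBSym (S : Schema.{u}) (Dom : Type v) : Type (max u v) where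
  | base (r : S.Sym) : EDBSym S Dom
  | U : EDBSym S Dom
  | Usi (d : Dir) (c : Dom) : EDBSym S Dom

abbrev edbSchema (S : Schema.{u}) (Dom : Type v) : Schema.{max u v} where
  Sym := EDBSym S Dom
  arity
    | .base r => S.arity r
    | .U => 2
    | .Usi _ _ => 1

/-- IDB predicates: the unary predicates `I_{θ c}` and `J_{θ c}` for `θ` one of `≤`, `≥`, and the
Boolean query predicate. -/
inductive IDBSym (Dom : Type v) : Type v where
  | I (d : Dir) (c : Dom) : IDBSym Dom
  | J (d : Dir) (c : Dom) : IDBSym Dom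
  | query : IDBSym Dom

abbrev idbSchema (Dom : Type v) : Schema.{v} where
  Sym := IDBSym Dom
  arity
    | .I _ _ => 1
    | .J _ _ => 1
    | .query => 0

section Atoms

variable {S : Schema.{u}} {Dom : Type v} {T : Type w}

def baseAtom (a : Atom S T) : Atom (edbSchema S Dom) T := ⟨.base a.sym, a.args⟩

/-- `U(s, t)` -/
def uAtom (s t : T) : Atom (edbSchema S Dom) T := ⟨.U, ![s, t]⟩

/-- `U_{θ c}(t)` -/
def usiAtom (d : Dir) (c : Dom) (t : T) : Atom (edbSchema S Dom) T := ⟨.Usi d c, ![t]⟩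

/-- `I_{θ c}(t)` -/
def iAtom (d : Dir) (c : Dom) (t : T) : Atom (idbSchema Dom) T := ⟨.I d c, ![t]⟩

/-- `J_{θ c}(t)` -/
def jAtom (d : Dir) (c : Dom) (t : T) : Atom (idbSchema Dom) T := ⟨.J d c, ![t]⟩

/-- The atom of the Boolean query predicate. -/
def queryAtom : Atom (idbSchema Dom) T := ⟨.query, ![]⟩

end Atoms

namespace Query

variable {S : Schema.{u}} {Dom : Type v} [LinearOrder Dom]

/-! ### The Datalog query of the containing query -/

open scoped Classical in
/-- The query rule: the relational subgoals and, for each comparison, its associated `I`-atom. -/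
noncomputable def queryRule (Q : Query S Dom) : Rule (edbSchema S Dom) (idbSchema Dom) Dom where
  head := queryAtom
  edb := Q.rel.image baseAtom
  idb := Q.closedSIs.image fun s => iAtom s.dir s.const (.var s.var)

open scoped Classical in
/-- The mapping rule of the comparison `e`: the `I`-atom of `e` is deleted from the body of the
query rule, and the head is the `J`-atom of `e`. -/
noncomputable def mappingRule (Q : Query S Dom) (e : ClosedSI Dom) :
    Rule (edbSchema S Dom) (idbSchema Dom) Dom where
  head := jAtom e.dir e.const (.var e.var)
  edb := Q.rel.image baseAtom
  idb := (Q.closedSIs.erase e).image fun s => iAtom s.dir s.const (.var s.var)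

/-- `I_{≤ c₂}(X) :- J_{≥ c₁}(X)` -/
noncomputable def couplingLe (S : Schema.{u}) (c₁ c₂ : Dom) :
    Rule (edbSchema S Dom) (idbSchema Dom) Dom where
  head := iAtom .le c₂ (.var 0)
  edb := ∅
  idb := {jAtom .ge c₁ (.var 0)}

/-- `I_{≥ c₁}(X) :- J_{≤ c₂}(X)` -/
noncomputable def couplingGe (S : Schema.{u}) (c₁ c₂ : Dom) :
    Rule (edbSchema S Dom) (idbSchema Dom) Dom where
  head := iAtom .ge c₁ (.var 0)
  edb := ∅
  idb := {jAtom .le c₂ (.var 0)}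

/-- `I_{≤ c₂}(X) :- J_{≥ c₁}(Y), U(X, Y)` -/
noncomputable def couplingU (S : Schema.{u}) (c₁ c₂ : Dom) :
    Rule (edbSchema S Dom) (idbSchema Dom) Dom where
  head := iAtom .le c₂ (.var 0)
  edb := {uAtom (.var 0) (.var 1)}
  idb := {jAtom .ge c₁ (.var 1)}

/-- The link rule `I_{θ c₁}(X) :- U_{θ c}(X)`. -/
noncomputable def linkRule (S : Schema.{u}) (d : Dir) (c c₁ : Dom) :
    Rule (edbSchema S Dom) (idbSchema Dom) Dom where
  head := iAtom d c₁ (.var 0)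
  edb := {usiAtom d c (.var 0)}
  idb := ∅

open scoped Classical in
/-- The Datalog query of `Q`, with the link rules for the semi-interval comparisons whose constant
lies in the finite set `C`: the query rule, a mapping rule for each comparison, three coupling rules
for each pair `c₁ ≤ c₂` of constants from the comparisons of `Q`, and a link rule
`I_{θ c₁}(X) :- U_{θ c}(X)` for `c` in `C` and each constant `c₁` from the comparisons of `Q`
for which `X θ c` implies `X θ c₁`. -/
noncomputable def toDatalog (Q : Query S Dom) (C : Finset Dom) :
    Datalog (edbSchema S Dom) (idbSchema Dom) Dom where
  rules :=
    {Q.queryRule} ∪ Q.closedSIs.image Q.mappingRule ∪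
    (((Q.acConsts ×ˢ Q.acConsts).filter fun p => p.1 ≤ p.2).biUnion fun p =>
      {couplingLe S p.1 p.2, couplingGe S p.1 p.2, couplingU S p.1 p.2}) ∪
    ({Dir.le, Dir.ge} : Finset Dir).biUnion (fun d =>
      ((C ×ˢ Q.acConsts).filter fun p =>
        ∀ x : Dom, d.toCmp.Holds x p.1 → d.toCmp.Holds x p.2).image fun p =>
          linkRule S d p.1 p.2)
  goal := .query
  goal_arity := rfl

/-! ### The conjunctive query of the contained query -/

open scoped Classical in
/-- The conjunctive query of `Q`: the relational subgoals; `U_{θ c}(t)` for each closed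
semi-interval comparison `t θ c` in the closure of the comparisons of `Q`, with `c` a constant of
`Q`; and `U(s, t)` for each comparison `s ≤ t` in the closure. Here terms with an implied equality
are identified, and `s`, `t` range over the terms in the relational subgoals. -/
noncomputable def toCQ (Q : Query S Dom) : CQ (edbSchema S Dom) Dom where
  body :=
    (Q.rel.image fun a => baseAtom (a.map Q.rep)) ∪
    ({Dir.le, Dir.ge} : Finset Dir).biUnion (fun d =>
      ((Q.relTerms ×ˢ Q.consts).filter fun p =>
        Q.Implies p.1 d.toCmp (.const p.2)).image fun p => usiAtom d p.2 (Q.rep p.1)) ∪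
    ((Q.relTerms ×ˢ Q.relTerms).filter fun p =>
      Q.Implies p.1 .le p.2).image fun p => uAtom (Q.rep p.1) (Q.rep p.2)

end Query

end CQAC

namespace CQAC

/-! Soundness of the Datalog query: read `U` and `U_{θ c}` as the true order on the domain. If Q₁ is
false on a database, every derived `I`-fact satisfies its comparison, every derived `J`-fact
violates it, and the query fact is never derived (`idbSound_of_derives`); a solution of Q₂ also
makes its conjunctive query true.

Completeness: let an assignment `g` make the conjunctive query of Q₂ true on D, and let `val t` be
the `g`-value of the representative of `t`. The aim is a solution `h` of the comparisons of Q₂ that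
identifies no more terms than these comparisons force, and that is extremal: `c < h(t)` whenever
`I_{≤ c}(val t)` is not derived, and `h(s) < d` whenever `J_{≥ d}(val s)` is derived but `I_{≥
d}(val s)` is not, where `d` is the constant of the only `≥` comparison of Q₁. Link rules make each
bound compatible with Q₂, and the coupling rule with `U` makes a lower and an upper bound compatible
with each other. In a dense order without endpoints this pairwise compatibility suffices
(`TermPreorder.exists_genericOn_of_bounds`).

Containment then maps Q₁ into the image of Q₂ under `h`, and this pulls back to a map into D. The
bounds force the `I`-facts of all `≤` comparisons; hence the mapping rule yields the `J`-fact of the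
`≥` comparison, the other bound forces its `I`-fact, and the query rule fires. Upper bounds are
imposed only where the `J`-fact is available, for otherwise they could clash with the lower ones. -/

theorem Term.var_injective {Dom : Type v} : Function.Injective (Term.var : Var → Term Dom) := by
  intro x y h
  cases h
  rfl

theorem Term.eval_update {Dom : Type v} {h : Var → Dom} {x : Var} {m : Dom} {t : Term Dom} (ht : t ≠ .var x) :
    t.eval (Function.update h x m) = t.eval h := by
  cases t with
  | var y =>
    have : y ≠ x := fun hyx => ht (hyx ▸ rfl)
    simp [Term.eval, this]
  | const c => rfl

/-! ### Generic valuations of preorders in a dense order without endpoints -/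

section Valuations

variable {Dom : Type v} [LinearOrder Dom]

/-- A finite cut of a dense order without endpoints contains a point outside a given finite set. -/
theorem exists_between_finsets_notMem [DenselyOrdered Dom] [NoMinOrder Dom] [NoMaxOrder Dom]
    [Nonempty Dom] (lo hi F : Finset Dom) (lo_lt_hi : ∀ x ∈ lo, ∀ y ∈ hi, x < y) :
    ∃ m, (∀ x ∈ lo, x < m) ∧ (∀ y ∈ hi, m < y) ∧ m ∉ F := by
  obtain ⟨m, hlo, hhi⟩ := Order.exists_between_finsets lo hi lo_lt_hi
  -- Split `F` at `m` and squeeze again: a point strictly between the two halves cannot lie in `F`.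
  obtain ⟨m', hlo', hhi'⟩ := Order.exists_between_finsets
    (lo ∪ F.filter (· ≤ m)) (hi ∪ F.filter (m < ·)) (by
      intro x hx y hy
      simp only [Finset.mem_union, Finset.mem_filter] at hx hy
      have hxm : x ≤ m := hx.elim (fun h => (hlo x h).le) And.right
      have hmy : m < y := hy.elim (hhi y) And.right
      exact hxm.trans_lt hmy)
  refine ⟨m', fun x hx => hlo' x (by simp [hx]), fun y hy => hhi' y (by simp [hy]), fun hF => ?_⟩
  rcases le_or_gt m' m with h | h
  · exact lt_irrefl _ (hlo' m' (by simp [hF, h]))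
  · exact lt_irrefl _ (hhi' m' (by simp [hF, h]))

/-- A preorder on terms that induces the given order on the constants. -/
structure TermPreorder (R : Term Dom → Term Dom → Prop) : Prop where
  refl : ∀ t, R t t
  trans : ∀ {s t u}, R s t → R t u → R s u
  const_iff : ∀ {a b : Dom}, R (.const a) (.const b) ↔ a ≤ b

/-- `h` is monotone on `T` and gives the same value to equivalent terms only. -/
def GenericOn (R : Term Dom → Term Dom → Prop) (T : Finset (Term Dom)) (h : Var → Dom) : Prop :=
  ∀ s ∈ T, ∀ t ∈ T, (R s t → s.eval h ≤ t.eval h) ∧ (s.eval h = t.eval h → R s t)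

theorem GenericOn.exists_value [DenselyOrdered Dom] [NoMinOrder Dom] [NoMaxOrder Dom]
    [Nonempty Dom] {R : Term Dom → Term Dom → Prop} (hR : TermPreorder R) {T : Finset (Term Dom)}
    {h : Var → Dom} (hT : GenericOn R T h) (t : Term Dom) :
    ∃ m, ∀ s ∈ T, (R s t → s.eval h ≤ m) ∧ (R t s → m ≤ s.eval h) ∧
      (s.eval h = m → R s t ∧ R t s) := by
  classical
  -- A term equivalent to an old one must copy its value; any other goes into its cut, away from all
  -- values already used.
  by_cases hs : ∃ s ∈ T, R s t ∧ R t s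
  · obtain ⟨s, hsT, hst, hts⟩ := hs
    refine ⟨s.eval h, fun r hr => ⟨fun hrt => ?_, fun htr => ?_, fun heq => ⟨?_, ?_⟩⟩⟩
    · exact (hT r hr s hsT).1 (hR.trans hrt hts)
    · exact (hT s hsT r hr).1 (hR.trans hst htr)
    · exact hR.trans ((hT r hr s hsT).2 heq) hst
    · exact hR.trans hts ((hT s hsT r hr).2 heq.symm)
  · push Not at hs
    obtain ⟨m, hlo, hhi, hm⟩ := exists_between_finsets_notMem
      ((T.filter (R · t)).image (Term.eval h)) ((T.filter (R t ·)).image (Term.eval h))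
      (T.image (Term.eval h)) (by
        simp only [Finset.mem_image, Finset.mem_filter]
        rintro _ ⟨r, ⟨hr, hrt⟩, rfl⟩ _ ⟨s, ⟨hs', hts⟩, rfl⟩
        refine lt_of_le_of_ne ((hT r hr s hs').1 (hR.trans hrt hts)) fun heq => ?_
        exact hs r hr hrt (hR.trans hts ((hT s hs' r hr).2 heq.symm)))
    refine ⟨m, fun s hsT => ⟨fun h1 => ?_, fun h1 => ?_, fun h1 => ?_⟩⟩
    · exact (hlo _ (Finset.mem_image_of_mem _ (Finset.mem_filter.2 ⟨hsT, h1⟩))).le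
    · exact (hhi _ (Finset.mem_image_of_mem _ (Finset.mem_filter.2 ⟨hsT, h1⟩))).le
    · exact absurd (h1 ▸ Finset.mem_image_of_mem _ hsT) hm

/-- Finitely many terms have a generic valuation for every preorder on terms. -/
theorem TermPreorder.exists_genericOn [DenselyOrdered Dom] [NoMinOrder Dom] [NoMaxOrder Dom]
    [Nonempty Dom] {R : Term Dom → Term Dom → Prop} (hR : TermPreorder R) (T : Finset (Term Dom)) :
    ∃ h, GenericOn R T h := by
  classical
  -- Constants carry fixed values, so they form the base case, and variables are then placed one at
  -- a time.
  have key : ∀ (K : Finset Dom) (V : Finset Var),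
      ∃ h, GenericOn R (V.image Term.var ∪ K.image Term.const) h := by
    intro K V
    induction V using Finset.induction_on with
    | empty =>
      refine ⟨fun _ => Classical.arbitrary Dom, fun s hs t ht => ?_⟩
      simp only [Finset.image_empty, Finset.empty_union, Finset.mem_image] at hs ht
      obtain ⟨a, -, rfl⟩ := hs
      obtain ⟨b, -, rfl⟩ := ht
      exact ⟨hR.const_iff.1, fun heq => hR.const_iff.2 (le_of_eq heq)⟩
    | insert x V hx ih =>
      obtain ⟨h, hh⟩ := ih
      obtain ⟨m, hm⟩ := hh.exists_value hR (.var x)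
      have hold : ∀ s ∈ V.image Term.var ∪ K.image Term.const, s ≠ Term.var x := by
        rintro s hs rfl
        simp [hx] at hs
      have hnew : (Term.var x : Term Dom).eval (Function.update h x m) = m := by
        simp [Term.eval]
      refine ⟨Function.update h x m, fun s hs t ht => ?_⟩
      rw [Finset.image_insert, Finset.insert_union, Finset.mem_insert] at hs ht
      rcases hs with rfl | hs <;> rcases ht with rfl | ht
      · exact ⟨fun _ => le_rfl, fun _ => hR.refl _⟩
      · rw [hnew, Term.eval_update (hold t ht)]
        exact ⟨(hm t ht).2.1, fun heq => ((hm t ht).2.2 heq.symm).2⟩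
      · rw [hnew, Term.eval_update (hold s hs)]
        exact ⟨(hm s hs).1, fun heq => ((hm s hs).2.2 heq).1⟩
      · rw [Term.eval_update (hold s hs), Term.eval_update (hold t ht)]
        exact hh s hs t ht
  obtain ⟨h, hh⟩ := key (T.preimage Term.const Term.const_injective.injOn)
    (T.preimage Term.var Term.var_injective.injOn)
  have hsub : ∀ t ∈ T, t ∈ (T.preimage Term.var Term.var_injective.injOn).image Term.var ∪
      (T.preimage Term.const Term.const_injective.injOn).image Term.const := by
    intro t ht
    cases t <;> simp [ht]
  exact ⟨h, fun s hs t ht => hh s (hsub s hs) t (hsub t ht)⟩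

/-- The preorder generated by `R` and the comparisons `c ≤ t` for `A t c`. -/
def WithLower (R : Term Dom → Term Dom → Prop) (A : Term Dom → Dom → Prop) (s t : Term Dom) :
    Prop :=
  R s t ∨ ∃ q c, A q c ∧ R s (.const c) ∧ R q t

/-- The preorder generated by `R` and the comparisons `s ≤ d` for `B s`. -/
def WithUpper (R : Term Dom → Term Dom → Prop) (B : Term Dom → Prop) (d : Dom) (s t : Term Dom) :
    Prop :=
  R s t ∨ ∃ p, B p ∧ R s p ∧ R (.const d) t

theorem TermPreorder.lt_of_not {R : Term Dom → Term Dom → Prop} (hR : TermPreorder R)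
    {t : Term Dom} {a b : Dom} (ha : ¬ R t (.const a)) (hb : R t (.const b)) : a < b :=
  lt_of_not_ge fun hba => ha (hR.trans hb (hR.const_iff.2 hba))

/-! ### Adjoining strict bounds to a preorder -/

section WithLower

variable {R : Term Dom → Term Dom → Prop} {A : Term Dom → Dom → Prop}

/-- One added edge per path is enough. If a path uses `c ≤ q` and then `c' ≤ q'`, it passes from `q`
to `c'`; since `q ≤ c` fails, `c < c'`, and the first added edge can be bypassed. -/
theorem TermPreorder.withLower (hR : TermPreorder R) (hA : ∀ t c, A t c → ¬ R t (.const c)) :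
    TermPreorder (WithLower R A) where
  refl t := .inl (hR.refl t)
  trans := by
    rintro s t u (h | ⟨q, c, hq, h, h'⟩) (k | ⟨q', c', hq', k, k'⟩)
    · exact .inl (hR.trans h k)
    · exact .inr ⟨q', c', hq', hR.trans h k, k'⟩
    · exact .inr ⟨q, c, hq, h, hR.trans h' k⟩
    · have hlt := hR.lt_of_not (hA q c hq) (hR.trans h' k)
      exact .inr ⟨q', c', hq', hR.trans h (hR.const_iff.2 hlt.le), k'⟩
  const_iff := by
    refine ⟨?_, fun h => .inl (hR.const_iff.2 h)⟩
    rintro (h | ⟨q, c, hq, h, h'⟩)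
    · exact hR.const_iff.1 h
    · exact (hR.const_iff.1 h).trans (hR.lt_of_not (hA q c hq) h').le

/-- No new equivalences arise, since a cycle through an added edge `c ≤ q` would give `q ≤ c`, or
two constants each below the other. This is what later makes the bounds strict without spoiling
genericity. -/
theorem WithLower.of_symm (hR : TermPreorder R) (hA : ∀ t c, A t c → ¬ R t (.const c))
    {s t : Term Dom} (hst : WithLower R A s t) (hts : WithLower R A t s) : R s t := by
  rcases hst with h | ⟨q, c, hq, h, h'⟩
  · exact h
  rcases hts with k | ⟨q', c', hq', k, k'⟩
  · exact absurd (hR.trans h' (hR.trans k h)) (hA q c hq)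
  · exact absurd (hR.lt_of_not (hA q c hq) (hR.trans h' k))
      (hR.lt_of_not (hA q' c' hq') (hR.trans k' h)).not_gt

theorem WithLower.not_of_mem (hR : TermPreorder R) (hA : ∀ t c, A t c → ¬ R t (.const c))
    {t : Term Dom} {c : Dom} (ht : A t c) : ¬ WithLower R A t (.const c) := by
  rintro (h | ⟨q, c', hq, h, h'⟩)
  · exact hA t c ht h
  · exact (hR.lt_of_not (hA t c ht) h).not_gt (hR.lt_of_not (hA q c' hq) h')

end WithLower

section WithUpper

variable {R : Term Dom → Term Dom → Prop} {B : Term Dom → Prop} {d : Dom}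

/-- All upper bounds share the constant `d`, so a path with two added edges shortcuts to its first
`p` followed by its last departure from `d`. -/
theorem TermPreorder.withUpper (hR : TermPreorder R) (hB : ∀ s, B s → ¬ R (.const d) s) :
    TermPreorder (WithUpper R B d) where
  refl t := .inl (hR.refl t)
  trans := by
    rintro s t u (h | ⟨p, hp, h, h'⟩) (k | ⟨p', hp', k, k'⟩)
    · exact .inl (hR.trans h k)
    · exact .inr ⟨p', hp', hR.trans h k, k'⟩
    · exact .inr ⟨p, hp, h, hR.trans h' k⟩
    · exact .inr ⟨p, hp, h, k'⟩
  const_iff := by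
    intro a b
    refine ⟨?_, fun h => .inl (hR.const_iff.2 h)⟩
    rintro (h | ⟨p, hp, h, h'⟩)
    · exact hR.const_iff.1 h
    · by_contra hab
      exact hB p hp (hR.trans (hR.trans h' (hR.const_iff.2 (le_of_not_ge hab))) h)

theorem WithUpper.of_symm (hR : TermPreorder R) (hB : ∀ s, B s → ¬ R (.const d) s)
    {s t : Term Dom} (hst : WithUpper R B d s t) (hts : WithUpper R B d t s) : R s t := by
  rcases hst with h | ⟨p, hp, h, h'⟩
  · exact h
  rcases hts with k | ⟨p', hp', k, k'⟩
  · exact absurd (hR.trans h' (hR.trans k h)) (hB p hp)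
  · exact absurd (hR.trans k' h) (hB p hp)

end WithUpper

/-- Strict lower bounds `c < t` and strict upper bounds `s < d` that are singly and pairwise
compatible with a preorder on terms are satisfied together by a valuation generic for it. -/
theorem TermPreorder.exists_genericOn_of_bounds [DenselyOrdered Dom] [NoMinOrder Dom]
    [NoMaxOrder Dom] [Nonempty Dom] {R : Term Dom → Term Dom → Prop} (hR : TermPreorder R)
    {A : Term Dom → Dom → Prop} {B : Term Dom → Prop} {d : Dom}
    (hA : ∀ t c, A t c → ¬ R t (.const c)) (hB : ∀ s, B s → ¬ R (.const d) s)
    (hAB : ∀ t c s, A t c → B s → d ≤ c → ¬ R t s) (T : Finset (Term Dom))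
    (hd : Term.const d ∈ T) :
    ∃ h, GenericOn R T h ∧ (∀ t c, A t c → t ∈ T → Term.const c ∈ T → c < t.eval h) ∧
      ∀ s, B s → s ∈ T → s.eval h < d := by
  have hR' := hR.withLower hA
  -- After the lower bounds are added, `d ≤ s` could only come from `d ≤ c ≤ q ≤ s`, which is a
  -- clash excluded by `hAB`.
  have hB' : ∀ s, B s → ¬ WithLower R A (.const d) s := by
    rintro s hs (h | ⟨q, c, hq, h, h'⟩)
    · exact hB s hs h
    · exact hAB q c s hq hs (hR.const_iff.1 h) h'
  have hA' : ∀ t c, A t c → ¬ WithUpper (WithLower R A) B d t (.const c) := by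
    rintro t c ht (h | ⟨p, hp, h, h'⟩)
    · exact WithLower.not_of_mem hR hA ht h
    · have hdc := hR'.const_iff.1 h'
      rcases h with h | ⟨q, c', hq, h, h''⟩
      · exact hAB t c p ht hp hdc h
      · exact hAB q c' p hq hp (hdc.trans (hR.lt_of_not (hA t c ht) h).le) h''
  obtain ⟨h, hh⟩ := (hR'.withUpper hB').exists_genericOn T
  refine ⟨h, fun s hs t ht => ⟨fun hst => (hh s hs t ht).1 (.inl (.inl hst)), fun heq => ?_⟩, ?_, ?_⟩
  · exact WithLower.of_symm hR hA
      (WithUpper.of_symm hR' hB' ((hh s hs t ht).2 heq) ((hh t ht s hs).2 heq.symm))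
      (WithUpper.of_symm hR' hB' ((hh t ht s hs).2 heq.symm) ((hh s hs t ht).2 heq))
  -- The weak bound is an edge of the enlarged preorder; equal values would also give its converse,
  -- which `hA'` forbids.
  · intro t c ht htT hcT
    refine lt_of_le_of_ne ((hh _ hcT t htT).1 (.inl (.inr ⟨t, c, ht, hR.refl _, hR.refl _⟩))) ?_
    exact fun heq => hA' t c ht ((hh t htT _ hcT).2 heq.symm)
  · intro s hs hsT
    refine lt_of_le_of_ne ((hh s hsT _ hd).1 (.inr ⟨s, hs, hR'.refl _, hR'.refl _⟩)) ?_
    intro heq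
    rcases (hh _ hd s hsT).2 heq.symm with h' | ⟨p, hp, h', -⟩
    · exact hB' s hs h'
    · exact hB' p hp h'

end Valuations

namespace Query

variable {S : Schema.{u}} {Dom : Type v} [LinearOrder Dom]

/-! ### The preorder generated by the comparisons of a query -/

/-- The weak inequality `s ≤ t` holds between constants or follows from a single comparison. -/
def Edge (Q : Query S Dom) (s t : Term Dom) : Prop :=
  (∃ a b, a ≤ b ∧ s = .const a ∧ t = .const b) ∨
  ∃ e ∈ Q.acs, ((e.op = .le ∨ e.op = .lt ∨ e.op = .eq) ∧ s = .var e.lhs ∧ t = e.rhs) ∨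
    ((e.op = .ge ∨ e.op = .gt ∨ e.op = .eq) ∧ s = e.rhs ∧ t = .var e.lhs)

def Reach (Q : Query S Dom) : Term Dom → Term Dom → Prop := Relation.ReflTransGen Q.Edge

theorem Edge.implies {Q : Query S Dom} {s t : Term Dom} (hst : Q.Edge s t) :
    Q.Implies s .le t := by
  intro h hh
  rcases hst with ⟨a, b, hab, rfl, rfl⟩ | ⟨e, he, ⟨hop, rfl, rfl⟩ | ⟨hop, rfl, rfl⟩⟩
  · exact hab
  all_goals
    have := hh e he
    rcases hop with hop | hop | hop <;>
      simp only [AC.Holds, hop, Cmp.Holds] at this <;>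
      simp only [Cmp.Holds, Term.eval]
    exacts [this, this.le, this ▸ le_rfl]

theorem Reach.implies {Q : Query S Dom} {s t : Term Dom} (hst : Q.Reach s t) :
    Q.Implies s .le t := by
  intro h hh
  induction hst with
  | refl => exact le_refl (s.eval h)
  | tail _ hbc ih => exact le_trans (α := Dom) ih (hbc.implies h hh)

theorem termPreorder_reach (Q : Query S Dom) : TermPreorder Q.Reach where
  refl _ := .refl
  trans := Relation.ReflTransGen.trans
  const_iff := by
    refine ⟨fun hab => ?_, fun hab => .single (.inl ⟨_, _, hab, rfl, rfl⟩)⟩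
    obtain ⟨h, hh⟩ := Q.consistent
    exact hab.implies h hh

theorem const_mem_consts_of_mem_relTerms {Q : Query S Dom} {c : Dom}
    (hc : Term.const c ∈ Q.relTerms) : c ∈ Q.consts := by
  simp [consts, hc]

theorem const_mem_acConsts {Q : Query S Dom} {e : AC Dom} (he : e ∈ Q.acs) {c : Dom}
    (hc : e.rhs = .const c) : c ∈ Q.acConsts := by
  simp only [acConsts, Finset.mem_preimage, Finset.mem_image]
  exact ⟨e, he, hc⟩

theorem const_mem_consts {Q : Query S Dom} {e : AC Dom} (he : e ∈ Q.acs) {c : Dom}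
    (hc : e.rhs = .const c) : c ∈ Q.consts := by
  simp [consts, const_mem_acConsts he hc]

/-- Link rules exist only for constants of Q₂, while `c` may come from Q₁. Stripping the final
constant-to-constant steps of a path leaves a constant of Q₂: the right side of a comparison, or `t`
itself. -/
theorem Reach.exists_const_le {Q : Query S Dom} {t : Term Dom} (ht : t ∈ Q.relTerms) {c : Dom}
    (htc : Q.Reach t (.const c)) : ∃ c' ∈ Q.consts, c' ≤ c ∧ Q.Reach t (.const c') := by
  generalize hu : Term.const c = u at htc
  induction htc generalizing c with
  | refl => exact ⟨c, const_mem_consts_of_mem_relTerms (hu ▸ ht), le_rfl, hu ▸ .refl⟩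
  | tail htu huv ih =>
    rcases id huv with ⟨a, b, hab, rfl, rfl⟩ | ⟨e, he, ⟨-, rfl, h⟩ | ⟨-, -, h⟩⟩
    · obtain ⟨c', hc', hle, hr⟩ := ih rfl
      cases hu
      exact ⟨c', hc', hle.trans hab, hr⟩
    · subst hu
      exact ⟨c, const_mem_consts he h.symm, le_rfl, htu.tail huv⟩
    · simp [h] at hu

theorem Reach.exists_const_ge {Q : Query S Dom} {t : Term Dom} (ht : t ∈ Q.relTerms) {c : Dom}
    (hct : Q.Reach (.const c) t) : ∃ c' ∈ Q.consts, c ≤ c' ∧ Q.Reach (.const c') t := by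
  generalize hu : Term.const c = u at hct
  induction hct using Relation.ReflTransGen.head_induction_on generalizing c with
  | refl => exact ⟨c, const_mem_consts_of_mem_relTerms (hu ▸ ht), le_rfl, hu ▸ .refl⟩
  | head huv hvt ih =>
    rcases id huv with ⟨a, b, hab, rfl, rfl⟩ | ⟨e, he, ⟨-, h, -⟩ | ⟨-, h, rfl⟩⟩
    · obtain ⟨c', hc', hle, hr⟩ := ih rfl
      cases hu
      exact ⟨c', hc', hab.trans hle, hr⟩
    · simp [h] at hu
    · subst hu
      exact ⟨c, const_mem_consts he h.symm, le_rfl, .head huv hvt⟩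

/-- A generic valuation satisfies the comparisons. -/
theorem holds_of_genericOn {Q : Query S Dom} {T : Finset (Term Dom)} {h : Var → Dom}
    (hh : GenericOn Q.Reach T h) (hT : ∀ e ∈ Q.acs, Term.var e.lhs ∈ T ∧ e.rhs ∈ T) :
    ∀ e ∈ Q.acs, e.Holds h := by
  intro e he
  obtain ⟨g, hg⟩ := Q.consistent
  have hge := hg e he
  obtain ⟨hl, hr⟩ := hT e he
  have hlr := hh _ hl _ hr
  have hrl := hh _ hr _ hl
  have hle : (e.op = .le ∨ e.op = .lt ∨ e.op = .eq) → h e.lhs ≤ e.rhs.eval h :=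
    fun hop => hlr.1 (.single (.inr ⟨e, he, .inl ⟨hop, rfl, rfl⟩⟩))
  have hge' : (e.op = .ge ∨ e.op = .gt ∨ e.op = .eq) → e.rhs.eval h ≤ h e.lhs :=
    fun hop => hrl.1 (.single (.inr ⟨e, he, .inr ⟨hop, rfl, rfl⟩⟩))
  -- Generic values coincide only if the equality is forced, so every solution `g` shares it;
  -- consistency then excludes it for `<`, `>` and `≠`.
  have hne : h e.lhs = e.rhs.eval h → g e.lhs = e.rhs.eval g := fun heq =>
    le_antisymm ((hlr.2 heq).implies g hg) ((hrl.2 heq.symm).implies g hg)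
  unfold AC.Holds at hge ⊢
  cases hop : e.op <;> simp only [hop, Cmp.Holds] at hge ⊢
  · exact lt_of_le_of_ne (hle (by simp [hop])) fun heq => hge.ne (hne heq)
  · exact lt_of_le_of_ne (hge' (by simp [hop])) fun heq => hge.ne' (hne heq.symm)
  · exact hle (by simp [hop])
  · exact hge' (by simp [hop])
  · exact le_antisymm (hle (by simp [hop])) (hge' (by simp [hop]))
  · exact fun heq => hge (hne heq)

/-! ### Representatives -/

theorem implies_rep (Q : Query S Dom) (t : Term Dom) : Q.Implies t .eq (Q.rep t) := by
  unfold rep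
  split_ifs with hc
  · exact hc.choose_spec
  · cases t with
    | var x =>
      exact Nat.sInf_mem (s := {y : Var | Q.Implies (.var x) .eq (.var y)}) ⟨x, fun _ _ => rfl⟩
    | const c => exact absurd ⟨c, fun _ _ => rfl⟩ hc

theorem eval_rep {Q : Query S Dom} {h : Var → Dom} (hh : ∀ e ∈ Q.acs, e.Holds h) (t : Term Dom) :
    (Q.rep t).eval h = t.eval h :=
  (Q.implies_rep t h hh).symm

theorem rep_eq_of_implies {Q : Query S Dom} {s t : Term Dom} (hst : Q.Implies s .eq t) :
    Q.rep s = Q.rep t := by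
  -- The representative depends on the term only through its set of forced equalities.
  have : Q.Implies s .eq = Q.Implies t .eq := funext fun u => propext
    ⟨fun k h hh => (hst h hh).symm.trans (k h hh), fun k h hh => (hst h hh).trans (k h hh)⟩
  unfold rep
  rw [this]

theorem rep_const (Q : Query S Dom) (c : Dom) : Q.rep (.const c) = .const c := by
  have hc : ∃ c' : Dom, Q.Implies (.const c) .eq (.const c') := ⟨c, fun _ _ => rfl⟩
  obtain ⟨h, hh⟩ := Q.consistent
  rw [rep, dif_pos hc, ← show c = hc.choose from hc.choose_spec h hh]

theorem Reach.rep_eq {Q : Query S Dom} {s t : Term Dom} (hst : Q.Reach s t) (hts : Q.Reach t s) :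
    Q.rep s = Q.rep t :=
  rep_eq_of_implies fun h hh => le_antisymm (α := Dom) (hst.implies h hh) (hts.implies h hh)

theorem mem_relTerms {Q : Query S Dom} {a : Atom S (Term Dom)} (ha : a ∈ Q.rel)
    (i : Fin (S.arity a.sym)) : a.args i ∈ Q.relTerms := by
  classical
  simp only [relTerms, Finset.mem_biUnion, Finset.mem_image]
  exact ⟨a, ha, i, Finset.mem_univ _, rfl⟩

theorem var_mem_relTerms {Q : Query S Dom} {e : AC Dom} (he : e ∈ Q.acs) :
    Term.var e.lhs ∈ Q.relTerms := by
  obtain ⟨a, ha, i, hi⟩ := Q.safe e he e.lhs (.inl rfl)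
  exact hi ▸ mem_relTerms ha i

theorem mem_closedSIs {Q : Query S Dom} {e : ClosedSI Dom} : e ∈ Q.closedSIs ↔ e.toAC ∈ Q.acs :=
  Finset.mem_preimage

theorem const_mem_acConsts_of_mem_closedSIs {Q : Query S Dom} {e : ClosedSI Dom}
    (he : e ∈ Q.closedSIs) : e.const ∈ Q.acConsts :=
  const_mem_acConsts (mem_closedSIs.1 he) rfl

end Query

/-! ### Images of atoms -/

section Map

variable {S : Schema.{u}} {Dom : Type v} {T : Type*} {T' : Type*} (f : T → T')

@[simp] theorem Atom.map_iAtom (d : Dir) (c : Dom) (t : T) :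
    (iAtom d c t).map f = iAtom d c (f t) :=
  congrArg (Atom.mk (S := idbSchema Dom) (IDBSym.I d c)) (funext fun i => by
    rw [Subsingleton.elim (α := Fin 1) i 0]; rfl)

@[simp] theorem Atom.map_jAtom (d : Dir) (c : Dom) (t : T) :
    (jAtom d c t).map f = jAtom d c (f t) :=
  congrArg (Atom.mk (S := idbSchema Dom) (IDBSym.J d c)) (funext fun i => by
    rw [Subsingleton.elim (α := Fin 1) i 0]; rfl)

@[simp] theorem Atom.map_usiAtom (d : Dir) (c : Dom) (t : T) :
    (usiAtom d c t : Atom (edbSchema S Dom) T).map f = usiAtom d c (f t) :=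
  congrArg (Atom.mk (S := edbSchema S Dom) (EDBSym.Usi d c)) (funext fun i => by
    rw [Subsingleton.elim (α := Fin 1) i 0]; rfl)

@[simp] theorem Atom.map_uAtom (s t : T) :
    (uAtom s t : Atom (edbSchema S Dom) T).map f = uAtom (f s) (f t) :=
  congrArg (Atom.mk (S := edbSchema S Dom) EDBSym.U) (funext (Fin.forall_fin_two.2 ⟨rfl, rfl⟩))

@[simp] theorem Atom.map_baseAtom (a : Atom S T) :
    (baseAtom a : Atom (edbSchema S Dom) T).map f = baseAtom (a.map f) := rfl

theorem Atom.map_queryAtom : (queryAtom : Atom (idbSchema Dom) T).map f = queryAtom :=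
  congrArg (Atom.mk (S := idbSchema Dom) IDBSym.query) (funext fun i => Fin.elim0 i)

end Map

namespace Query

variable {S : Schema.{u}} {Dom : Type v} [LinearOrder Dom]

/-! ### The rules -/

theorem mem_rules {Q : Query S Dom} {C : Finset Dom}
    {r : Rule (edbSchema S Dom) (idbSchema Dom) Dom} :
    r ∈ (Q.toDatalog C).rules ↔
      r = Q.queryRule ∨ (∃ e ∈ Q.closedSIs, r = Q.mappingRule e) ∨
      (∃ c₁ ∈ Q.acConsts, ∃ c₂ ∈ Q.acConsts, c₁ ≤ c₂ ∧
        (r = couplingLe S c₁ c₂ ∨ r = couplingGe S c₁ c₂ ∨ r = couplingU S c₁ c₂)) ∨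
      ∃ d : Dir, ∃ c ∈ C, ∃ c₁ ∈ Q.acConsts,
        (∀ x : Dom, d.toCmp.Holds x c → d.toCmp.Holds x c₁) ∧ r = linkRule S d c c₁ := by
  classical
  simp only [toDatalog, Finset.mem_union, Finset.mem_singleton, Finset.mem_image,
    Finset.mem_biUnion, Finset.mem_filter, Finset.mem_product, Finset.mem_insert, Prod.exists,
    or_assoc]
  refine or_congr Iff.rfl (or_congr ?_ (or_congr ?_ ?_))
  · exact exists_congr fun e => and_congr_right fun _ => eq_comm
  · constructor
    · rintro ⟨a, b, ⟨⟨ha, hb⟩, hab⟩, h⟩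
      exact ⟨a, ha, b, hb, hab, h⟩
    · rintro ⟨a, ha, b, hb, hab, h⟩
      exact ⟨a, b, ⟨⟨ha, hb⟩, hab⟩, h⟩
  · constructor
    · rintro ⟨d, -, a, b, ⟨⟨ha, hb⟩, hab⟩, h⟩
      exact ⟨d, a, ha, b, hb, hab, h.symm⟩
    · rintro ⟨d, a, ha, b, hb, hab, h⟩
      exact ⟨d, by cases d <;> simp, a, b, ⟨⟨ha, hb⟩, hab⟩, h.symm⟩

section Derives

variable {Q : Query S Dom} {C : Finset Dom} {D : Database (edbSchema S Dom) Dom}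

theorem trueOn_of_derives (h : (Q.toDatalog C).Derives D queryAtom) : (Q.toDatalog C).TrueOn D := by
  have : (queryAtom : Atom (idbSchema Dom) Dom) =
      ⟨(Q.toDatalog C).goal, fun i => (Fin.cast (Q.toDatalog C).goal_arity i).elim0⟩ :=
    congrArg (Atom.mk (S := idbSchema Dom) IDBSym.query) (funext fun i => Fin.elim0 i)
  unfold Datalog.TrueOn
  rwa [← this]

theorem derives_query (k : Var → Dom) (hrel : ∀ a ∈ Q.rel, baseAtom (a.map (Term.eval k)) ∈ D)
    (hI : ∀ e ∈ Q.closedSIs, (Q.toDatalog C).Derives D (iAtom e.dir e.const (k e.var))) :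
    (Q.toDatalog C).Derives D queryAtom := by
  rw [← Atom.map_queryAtom (Term.eval k)]
  refine .fire Q.queryRule (mem_rules.2 (.inl rfl)) k ?_ ?_
  · simpa [queryRule] using hrel
  · simpa [queryRule, Term.eval] using hI

theorem derives_mapping {e : ClosedSI Dom} (he : e ∈ Q.closedSIs) (k : Var → Dom)
    (hrel : ∀ a ∈ Q.rel, baseAtom (a.map (Term.eval k)) ∈ D)
    (hI : ∀ e' ∈ Q.closedSIs, e' ≠ e →
      (Q.toDatalog C).Derives D (iAtom e'.dir e'.const (k e'.var))) :
    (Q.toDatalog C).Derives D (jAtom e.dir e.const (k e.var)) := by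
  have := Datalog.Derives.fire (P := Q.toDatalog C) (D := D) (Q.mappingRule e)
    (mem_rules.2 (.inr (.inl ⟨e, he, rfl⟩))) k (by simpa [mappingRule] using hrel) (by
      simp only [mappingRule, Finset.mem_image, Finset.mem_erase]
      rintro _ ⟨e', ⟨hne, he'⟩, rfl⟩
      simpa [Term.eval] using hI e' he' hne)
  simpa [mappingRule, Term.eval] using this

theorem derives_couplingU {c₁ c₂ : Dom} (h₁ : c₁ ∈ Q.acConsts) (h₂ : c₂ ∈ Q.acConsts)
    (h₁₂ : c₁ ≤ c₂) {a b : Dom} (hab : uAtom a b ∈ D)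
    (hJ : (Q.toDatalog C).Derives D (jAtom .ge c₁ b)) :
    (Q.toDatalog C).Derives D (iAtom .le c₂ a) := by
  have := Datalog.Derives.fire (P := Q.toDatalog C) (D := D) (couplingU S c₁ c₂)
    (mem_rules.2 (.inr (.inr (.inl ⟨c₁, h₁, c₂, h₂, h₁₂, .inr (.inr rfl)⟩))))
    (fun x => if x = 0 then a else b)
    (by simpa [couplingU, Term.eval] using hab) (by simpa [couplingU, Term.eval] using hJ)
  simpa [couplingU, Term.eval] using this

theorem derives_link {d : Dir} {c c₁ : Dom} (hc : c ∈ C) (hc₁ : c₁ ∈ Q.acConsts)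
    (himp : ∀ x : Dom, d.toCmp.Holds x c → d.toCmp.Holds x c₁) {a : Dom}
    (ha : usiAtom d c a ∈ D) : (Q.toDatalog C).Derives D (iAtom d c₁ a) := by
  have := Datalog.Derives.fire (P := Q.toDatalog C) (D := D) (linkRule S d c c₁)
    (mem_rules.2 (.inr (.inr (.inr ⟨d, c, hc, c₁, hc₁, himp, rfl⟩)))) (fun _ => a)
    (by simpa [linkRule, Term.eval] using ha) (by simp [linkRule])
  simpa [linkRule, Term.eval] using this

end Derives

/-! ### The Datalog query is sound -/

/-- The database in which `U` and `U_{θ c}` are the comparisons of the domain. -/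
def orderDatabase (D : Database S Dom) : Database (edbSchema S Dom) Dom :=
  {a | match a with
    | ⟨.base r, v⟩ => (⟨r, v⟩ : Atom S Dom) ∈ D
    | ⟨.U, v⟩ => (v 0 : Dom) ≤ v 1
    | ⟨.Usi d c, v⟩ => d.toCmp.Holds (v 0) c}

/-- `I`-facts satisfy their comparison, `J`-facts violate it, and the query fact is absent. -/
def IDBSound : Atom (idbSchema Dom) Dom → Prop
  | ⟨.I d c, v⟩ => d.toCmp.Holds (v 0) c
  | ⟨.J d c, v⟩ => ¬ d.toCmp.Holds (v 0) c
  | ⟨.query, _⟩ => False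

/-- By induction on derivations. A firing query rule would make Q₁ true, and so would a mapping rule
whose deleted comparison held. In the coupling rules, failure of `Y ≥ c₁` gives `Y < c₁ ≤ c₂`, hence
`X ≤ c₂` for `X ≤ Y`; dually for `≥`. -/
theorem idbSound_of_derives {Q : Query S Dom} (hQ : ∀ e ∈ Q.acs, ∃ s : ClosedSI Dom, s.toAC = e)
    {C : Finset Dom} {D : Database S Dom} (hD : ¬ Q.TrueOn D) {b : Atom (idbSchema Dom) Dom}
    (hb : (Q.toDatalog C).Derives (orderDatabase D) b) : IDBSound b := by
  classical
  induction hb with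
  | fire r hr h hedb _ ih =>
    have hacs : ∀ {s : ClosedSI Dom}, IDBSound ((iAtom s.dir s.const (Term.var s.var)).map
        (Term.eval h)) → s.toAC.Holds h := fun hs => by
      rw [Atom.map_iAtom] at hs
      exact hs
    rcases mem_rules.1 hr with rfl | ⟨e, he, rfl⟩ | ⟨c₁, -, c₂, -, hc, rfl | rfl | rfl⟩ |
      ⟨d, c, -, c₁, -, himp, rfl⟩
    · refine hD ⟨h, fun a ha => hedb _ (Finset.mem_image_of_mem _ ha), fun e he => ?_⟩
      obtain ⟨s, rfl⟩ := hQ e he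
      exact hacs (ih _ (Finset.mem_image_of_mem _ (mem_closedSIs.2 he)))
    · intro hholds
      refine hD ⟨h, fun a ha => hedb _ (Finset.mem_image_of_mem _ ha), fun e' he' => ?_⟩
      obtain ⟨s, rfl⟩ := hQ e' he'
      by_cases hse : s = e
      · subst hse
        exact hholds
      · exact hacs (ih _ (Finset.mem_image_of_mem _
          (Finset.mem_erase.2 ⟨hse, mem_closedSIs.2 he'⟩)))
    · have := ih _ (Finset.mem_singleton_self _)
      exact (le_of_not_ge (α := Dom) this).trans hc
    · have := ih _ (Finset.mem_singleton_self _)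
      exact hc.trans (le_of_not_ge (α := Dom) this)
    · have hJ := ih _ (Finset.mem_singleton_self _)
      have hU := hedb _ (Finset.mem_singleton_self _)
      exact le_trans (α := Dom) hU ((le_of_not_ge (α := Dom) hJ).trans hc)
    · exact himp _ (hedb _ (Finset.mem_singleton_self _))

theorem mem_toCQ_rel (Q : Query S Dom) {a : Atom S (Term Dom)} (ha : a ∈ Q.rel) :
    baseAtom (a.map Q.rep) ∈ Q.toCQ.body := by
  classical
  simp only [toCQ, Finset.mem_union, Finset.mem_image]
  exact .inl (.inl ⟨a, ha, rfl⟩)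

theorem mem_toCQ_usi (Q : Query S Dom) {d : Dir} {t : Term Dom} {c : Dom} (ht : t ∈ Q.relTerms)
    (hc : c ∈ Q.consts) (himp : Q.Implies t d.toCmp (.const c)) :
    usiAtom d c (Q.rep t) ∈ Q.toCQ.body := by
  classical
  simp only [toCQ, Finset.mem_union, Finset.mem_image, Finset.mem_biUnion, Finset.mem_filter,
    Finset.mem_product]
  exact .inl (.inr ⟨d, by cases d <;> simp, (t, c), ⟨⟨ht, hc⟩, himp⟩, rfl⟩)

theorem mem_toCQ_u (Q : Query S Dom) {s t : Term Dom} (hs : s ∈ Q.relTerms) (ht : t ∈ Q.relTerms)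
    (himp : Q.Implies s .le t) : uAtom (Q.rep s) (Q.rep t) ∈ Q.toCQ.body := by
  classical
  simp only [toCQ, Finset.mem_union, Finset.mem_image, Finset.mem_filter, Finset.mem_product]
  exact .inr ⟨(s, t), ⟨⟨hs, ht⟩, himp⟩, rfl⟩

theorem toCQ_trueOn_orderDatabase {Q : Query S Dom} {D : Database S Dom} (hD : Q.TrueOn D) :
    Q.toCQ.TrueOn (orderDatabase D) := by
  classical
  obtain ⟨h, hrel, hacs⟩ := hD
  refine ⟨h, fun a ha => ?_⟩
  simp only [toCQ, Finset.mem_union, Finset.mem_image, Finset.mem_biUnion, Finset.mem_filter,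
    Finset.mem_product] at ha
  rcases ha with (⟨b, hb, rfl⟩ | ⟨d, -, p, ⟨-, himp⟩, rfl⟩) | ⟨p, ⟨-, himp⟩, rfl⟩
  · have : (b.map Q.rep).map (Term.eval h) = b.map (Term.eval h) :=
      congrArg (Atom.mk b.sym) (funext fun i => eval_rep hacs _)
    rw [Atom.map_baseAtom, this]
    exact hrel b hb
  · rw [Atom.map_usiAtom, eval_rep hacs]
    exact himp h hacs
  · rw [Atom.map_uAtom, eval_rep hacs, eval_rep hacs]
    exact himp h hacs

theorem containedIn_of_toCQ_containedIn {Q₁ Q₂ : Query S Dom}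
    (hQ₁ : ∀ e ∈ Q₁.acs, ∃ s : ClosedSI Dom, s.toAC = e) {C : Finset Dom}
    (hcont : Q₂.toCQ.ContainedIn (Q₁.toDatalog C)) : Q₂.ContainedIn Q₁ := by
  intro D hD
  by_contra hD'
  exact idbSound_of_derives hQ₁ hD' (hcont _ (toCQ_trueOn_orderDatabase hD))

/-! ### The Datalog query is complete -/

theorem toCQ_containedIn_of_containedIn [DenselyOrdered Dom] [NoMinOrder Dom] [NoMaxOrder Dom]
    [Nonempty Dom] {Q₁ Q₂ : Query S Dom} (hQ₁ : Q₁.IsClosedRSI1) (hcont : Q₂.ContainedIn Q₁) :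
    Q₂.toCQ.ContainedIn (Q₁.toDatalog Q₂.consts) := by
  classical
  rintro D ⟨g, hg⟩
  refine trueOn_of_derives ?_
  by_contra hquery
  set P := Q₁.toDatalog Q₂.consts
  let val : Term Dom → Dom := fun t => (Q₂.rep t).eval g
  -- When Q₁ has no `≥` comparison, any `d` will do.
  obtain ⟨d, hd⟩ : ∃ d, ∀ e ∈ Q₁.closedSIs, e.dir = .ge → e.const = d := by
    by_cases hex : ∃ e ∈ Q₁.closedSIs, e.dir = .ge
    · obtain ⟨e, he, hge⟩ := hex
      exact ⟨e.const, fun e' he' hge' => by rw [hQ₁.2 e' he' e he hge' hge]⟩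
    · exact ⟨Classical.arbitrary Dom, fun e he hge => absurd ⟨e, he, hge⟩ hex⟩
  -- Underivable `I`-facts become strict bounds contradicting their comparisons. Membership in
  -- `Q₁.acConsts` guarantees that the needed link and coupling rules are present.
  let A : Term Dom → Dom → Prop := fun t c =>
    t ∈ Q₂.relTerms ∧ c ∈ Q₁.acConsts ∧ ¬ P.Derives D (iAtom .le c (val t))
  let B : Term Dom → Prop := fun s => s ∈ Q₂.relTerms ∧ d ∈ Q₁.acConsts ∧
    P.Derives D (jAtom .ge d (val s)) ∧ ¬ P.Derives D (iAtom .ge d (val s))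
  let T : Finset (Term Dom) := insert (.const d) (Q₂.relTerms ∪ Q₂.acs.image AC.rhs ∪
    (Q₁.consts.image Term.const))
  have hT₂ : ∀ t ∈ Q₂.relTerms, t ∈ T := fun t ht => by simp [T, ht]
  have hT₁ : ∀ c ∈ Q₁.consts, Term.const c ∈ T := fun c hc => by
    simp only [T, Finset.mem_insert, Finset.mem_union, Finset.mem_image]
    exact .inr (.inr ⟨c, hc, rfl⟩)
  have hac : ∀ c ∈ Q₁.acConsts, c ∈ Q₁.consts := fun c hc => by simp [consts, hc]
  obtain ⟨h, hgen, hlow, hup⟩ := Q₂.termPreorder_reach.exists_genericOn_of_bounds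
    (A := A) (B := B) (d := d)
    (by
      rintro t c ⟨ht, hc, hI⟩ hreach
      obtain ⟨c', hc', hle, hr⟩ := hreach.exists_const_le ht
      refine hI (derives_link hc' hc (fun x hx => le_trans (α := Dom) hx hle) ?_)
      have := hg _ (Q₂.mem_toCQ_usi (d := .le) ht hc' hr.implies)
      rwa [Atom.map_usiAtom] at this)
    (by
      rintro s ⟨hs, hd, -, hI⟩ hreach
      obtain ⟨c', hc', hle, hr⟩ := hreach.exists_const_ge hs
      refine hI (derives_link hc' hd (fun x hx => le_trans (α := Dom) hle hx) ?_)
      have := hg _ (Q₂.mem_toCQ_usi (d := .ge) hs hc' hr.implies)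
      rwa [Atom.map_usiAtom] at this)
    (by
      rintro t c s ⟨ht, hc, hI⟩ ⟨hs, hd, hJ, -⟩ hdc hreach
      refine hI (derives_couplingU hd hc hdc ?_ hJ)
      have := hg _ (Q₂.mem_toCQ_u ht hs hreach.implies)
      rwa [Atom.map_uAtom] at this)
    T (Finset.mem_insert_self _ _)
  have hacs := holds_of_genericOn hgen fun e he =>
    ⟨hT₂ _ (var_mem_relTerms he), by
      simp only [T, Finset.mem_insert, Finset.mem_union, Finset.mem_image]
      exact .inr (.inl (.inr ⟨e, he, rfl⟩))⟩
  -- The canonical database: the subgoals of Q₂ frozen by `h`.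
  obtain ⟨k, hkrel, hkacs⟩ := hcont ((fun a : Atom S (Term Dom) => a.map (Term.eval h)) '' Q₂.rel)
    ⟨h, fun a ha => ⟨a, ha, rfl⟩, hacs⟩
  have hval : ∀ s ∈ T, ∀ t ∈ T, s.eval h = t.eval h → val s = val t := fun s hs t ht heq =>
    congrArg (Term.eval g)
      (((hgen s hs t ht).2 heq).rep_eq ((hgen t ht s hs).2 heq.symm))
  -- `φ` undoes the freezing; genericity makes it independent of the chosen term. Its default value
  -- plays no role, because the subgoals of Q₁ land on values of terms of Q₂.
  let φ : Dom → Dom := fun x =>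
    if hx : ∃ t ∈ Q₂.relTerms, t.eval h = x then val hx.choose else x
  have hφ : ∀ t ∈ Q₂.relTerms, φ (t.eval h) = val t := by
    intro t ht
    have hx : ∃ s ∈ Q₂.relTerms, s.eval h = t.eval h := ⟨t, ht, rfl⟩
    simp only [φ, dif_pos hx]
    exact hval _ (hT₂ _ hx.choose_spec.1) _ (hT₂ t ht) hx.choose_spec.2
  have hpre : ∀ a ∈ Q₁.rel, ∀ i, ∃ t ∈ Q₂.relTerms,
      t.eval h = (a.args i).eval k ∧ (a.args i).eval (φ ∘ k) = val t := by
    intro a ha i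
    obtain ⟨b, hb, hba⟩ := hkrel a ha
    obtain ⟨t, ht, heq⟩ : ∃ t ∈ Q₂.relTerms, t.eval h = (a.args i).eval k := by
      obtain ⟨r, v⟩ := a
      obtain ⟨r', w⟩ := b
      simp only [Atom.map, Atom.mk.injEq] at hba
      obtain ⟨rfl, hvw⟩ := hba
      exact ⟨w i, mem_relTerms hb i, congrFun (eq_of_heq hvw) i⟩
    refine ⟨t, ht, heq, ?_⟩
    cases hai : a.args i with
    | var x =>
      rw [← hφ t ht, heq, hai]
      rfl
    | const c =>
      rw [hai] at heq
      -- Constants of Q₁ were put into `T` so that a term of Q₂ with value `c` is forced equal to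
      -- `c`; the pulled-back map thus respects constants.
      have hc : Term.const c ∈ T :=
        hT₁ c (const_mem_consts_of_mem_relTerms (hai ▸ mem_relTerms ha i))
      rw [hval t (hT₂ t ht) _ hc heq]
      simp only [val, rep_const]
      rfl
  have hrel : ∀ a ∈ Q₁.rel, baseAtom (a.map (Term.eval (φ ∘ k))) ∈ D := by
    intro a ha
    obtain ⟨b, hb, hba⟩ := hkrel a ha
    have := hg _ (Q₂.mem_toCQ_rel hb)
    rw [Atom.map_baseAtom] at this
    convert this using 2
    obtain ⟨r, v⟩ := a
    obtain ⟨r', w⟩ := b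
    simp only [Atom.map, Atom.mk.injEq] at hba
    obtain ⟨rfl, hvw⟩ := hba
    refine congrArg (Atom.mk r') (funext fun i => ?_)
    obtain ⟨t, ht, heq, hv⟩ := hpre _ ha i
    rw [hv]
    exact hval t (hT₂ t ht) (w i) (hT₂ _ (mem_relTerms hb i))
      (heq.trans (congrFun (eq_of_heq hvw) i).symm)
  have hvar : ∀ e ∈ Q₁.closedSIs, ∃ t ∈ Q₂.relTerms, t.eval h = k e.var ∧ φ (k e.var) = val t := by
    intro e he
    obtain ⟨a, ha, i, hi⟩ := Q₁.safe _ (mem_closedSIs.1 he) e.var (.inl rfl)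
    simpa [hi, Term.eval] using hpre a ha i
  have hle : ∀ e ∈ Q₁.closedSIs, e.dir = .le →
      P.Derives D (iAtom e.dir e.const (φ (k e.var))) := by
    intro e he hdir
    by_contra hI
    obtain ⟨t, ht, heq, hv⟩ := hvar e he
    have hc := const_mem_acConsts_of_mem_closedSIs he
    rw [hv, hdir] at hI
    have hlt := hlow t e.const ⟨ht, hc, hI⟩ (hT₂ t ht) (hT₁ _ (hac _ hc))
    have hholds := hkacs _ (mem_closedSIs.1 he)
    simp only [AC.Holds, ClosedSI.toAC, hdir] at hholds
    exact (heq ▸ hlt).not_ge hholds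
  refine hquery (derives_query (φ ∘ k) hrel fun e he => ?_)
  cases hdir : e.dir with
  | le => exact hdir ▸ hle e he hdir
  | ge =>
    by_contra hI
    obtain ⟨t, ht, heq, hv⟩ := hvar e he
    have hc := const_mem_acConsts_of_mem_closedSIs he
    have hed := hd e he hdir
    -- Uniqueness of the `≥` comparison leaves only `≤` comparisons in this mapping rule's body, and
    -- their `I`-facts are already derived.
    have hJ := derives_mapping (C := Q₂.consts) he (φ ∘ k) hrel fun e' he' hne => by
      cases hdir' : e'.dir with
      | le => exact hdir' ▸ hle e' he' hdir'
      | ge => exact absurd (hQ₁.2 e' he' e he hdir' hdir) hne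
    simp only [Function.comp_apply, hv, hed] at hI hJ
    rw [hdir] at hJ
    have hlt := hup t ⟨ht, hed ▸ hc, hJ, hI⟩ (hT₂ t ht)
    have hholds := hkacs _ (mem_closedSIs.1 he)
    simp only [AC.Holds, ClosedSI.toAC, hdir] at hholds
    exact (heq ▸ hlt).not_ge (hed ▸ hholds)

end Query

end CQAC

theorem mainTheorem3 {S : CQAC.Schema.{u}} {Dom : Type v} [LinearOrder Dom]
    [DenselyOrdered Dom] [NoMinOrder Dom] [NoMaxOrder Dom] [Nonempty Dom]
    (Q₁ Q₂ : CQAC.Query S Dom) (hQ₁ : Q₁.IsClosedRSI1) :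
    Q₂.ContainedIn Q₁ ↔ Q₂.toCQ.ContainedIn (Q₁.toDatalog Q₂.consts) :=
  ⟨CQAC.Query.toCQ_containedIn_of_containedIn hQ₁,
    CQAC.Query.containedIn_of_toCQ_containedIn hQ₁.1⟩
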